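/- Let $S$ be a commutative ring with unit, $Q$ a (not necessarily finite) group and $\kappa_Q\colon Q\to \mathrm{Aut}(S)$ a (not necessarily injective) action of $Q$ on $S$ by ring automorphisms. Let $A$ be a central $S$-algebra, i.e. an algebra with center $S$. Write $\mathrm U(\cdot)$ for the group of units, $\mathrm{Aut}(A)$ for the group of ring automorphisms of $A$, and $\mathrm{Out}(A)$ for its quotient by the group of inner automorphisms. A $Q$-normal structure on $A$ is a homomorphism $\sigma\colon Q\to\mathrm{Out}(A)$ whose composite with the restriction map $\mathrm{Out}(A)\to \mathrm{Aut}(S)$ is $\kappa_Q$; it is *equivariant* if it is induced by a homomorphism $\tau\colon Q\to\mathrm{Aut}(A)$ (which then induces $\kappa_Q$). Let $B^\sigma=\mathrm{Aut}(A)\times_{\mathrm{Out}(A)}Q$. The *Teichmüller class* $[\mathrm e_{(A,\sigma)}]\in \mathrm H^3(Q,\mathrm U(S))$ is the class represented by the crossed $2$-fold extension $$\mathrm e_{(A,\sigma)}\colon\ 1\to \mathrm U(S)\to \mathrm U(A)\to B^\sigma\to Q\to 1 .$$ For a non-empty index set $I$ let $\mathrm M_I(A)$ be the matrix algebra, understood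 for infinite $I$ as the ring of endomorphisms of the left $A^{\mathrm{op}}$-module $\bigoplus_I A^{\mathrm{op}}$; it is again a central $S$-algebra, and applying automorphisms of $A$ to the entries turns a $Q$-normal structure $\sigma$ on $A$ into a $Q$-normal structure $\sigma_I$ on $\mathrm M_I(A)$. **Theorem.** Let $(A,\sigma)$ be a $Q$-normal central $S$-algebra. 1. The Teichmüller class $[\mathrm e_{(A,\sigma)}]$ is zero if and only if, for $I=Q$, the $Q$-normal structure $\sigma_Q$ on $\mathrm M_Q(A)$ is equivariant. 2. Suppose that $S$ is a Galois extension of $R=S^Q$ with Galois group $Q$, i.e. $Q$ is finite, $\kappa_Q$ is injective, and the map $S\otimes_R S\to\mathrm{Map}(Q,S)$, $s\otimes t\mapsto (q\mapsto s\cdot{}^q t)$, is bijective. Then $[\mathrm e_{(A,\sigma)}]$ is zero if and only if, for some non-empty set $I$, $(\mathrm M_I(A),\sigma_I)$ arises by scalar extension, i.e. there are a central $R$-algebra $B$ and an isomorphism $S\otimes_R B\cong \mathrm M_I(A)$ of $S$-algebras under which $\sigma_I$ corresponds to the $Q$-normal structure induced by the action $q\mapsto \kappa_Q(q)\otimes\mathrm{id}_B$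 of $Q$ on $S\otimes_R B$. -/

import Mathlib

open scoped TensorProduct

universe u v w

-- the action of a group on the units of a ring induced by an action on the ring
attribute [local instance] Units.mulDistribMulActionRight

noncomputable section

/-! ## Crossed modules and crossed 2-fold extensions -/

/-- A crossed module `∂ : C → Γ`; the left action of `Γ` on `C` by group automorphisms is the
`MulDistribMulAction` instance. -/
structure CrossedModule (C Γ : Type*) [Group C] [Group Γ] [MulDistribMulAction Γ C] where
  boundary : C →* Γ
  boundary_smul : ∀ (γ : Γ) (c : C), boundary (γ • c) = γ * boundary c * γ⁻¹
  peiffer : ∀ b c : C, boundary b • c = b * c * b⁻¹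

/-- A crossed 2-fold extension `1 → M → C → Γ → G → 1`: an exact sequence of groups whose middle
map is a crossed module, such that the induced action of `G` on `M` is the given one. -/
structure CrossedTwoFoldExtension (M C Γ G : Type*) [CommGroup M] [Group C] [Group Γ] [Group G]
    [MulDistribMulAction Γ C] [MulDistribMulAction G M] extends CrossedModule C Γ where
  incl : M →* C
  incl_injective : Function.Injective incl
  range_incl : incl.range = boundary.ker
  proj : Γ →* G
  range_boundary : boundary.range = proj.ker
  proj_surjective : Function.Surjective proj
  incl_smul : ∀ (γ : Γ) (m : M), incl (proj γ • m) = γ • incl m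

/-- The `G`-module `M`, written additively, as a representation of `G` over the integers
(lifted to the universe of `G` and `M`). -/
def gModule (G M : Type u) [Group G] [CommGroup M] [MulDistribMulAction G M] :
    Rep.{u} (ULift.{u} ℤ) G :=
  Rep.of (X := Additive M)
    { toFun := fun g =>
        { toFun := fun m => Additive.ofMul (g • m.toMul)
          map_add' := fun a b => smul_mul' g a.toMul b.toMul
          map_smul' := fun n a =>
            (MulDistribMulAction.toMonoidHom M g).map_zpow a.toMul (ULift.down n) }
      map_one' := LinearMap.ext fun m => one_smul G (Additive.toMul m)
      map_mul' := fun g h => LinearMap.ext fun m => mul_smul g h (Additive.toMul m) }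

/-- An element of `M` as an element of the representation `gModule G M`. -/
def toGModule {G M : Type u} [Group G] [CommGroup M] [MulDistribMulAction G M] (m : M) :
    gModule G M := Additive.ofMul m

/-- The third cohomology group of the group `G` with coefficients in the `G`-module `M`. -/
abbrev H3 (G M : Type u) [Group G] [CommGroup M] [MulDistribMulAction G M] :
    ModuleCat (ULift.{u} ℤ) :=
  groupCohomology (gModule G M) 3

section Differentials

variable {G M : Type u} [Group G] [CommGroup M] [MulDistribMulAction G M]

theorem toGModule_mul (a b : M) :
    (toGModule (a * b) : gModule G M) = toGModule a + toGModule b := rfl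

theorem toGModule_inv (a : M) : (toGModule a⁻¹ : gModule G M) = -toGModule a := rfl

theorem gModule_rho_apply (g : G) (a : M) :
    (gModule G M).ρ g (toGModule a) = toGModule (g • a) := rfl

theorem d_two_toGModule (f : G → G → M) (g : Fin 3 → G) :
    inhomogeneousCochains.d (gModule G M) 2 (fun h => toGModule (f (h 0) (h 1))) g =
      toGModule (g 0 • f (g 1) (g 2) * (f (g 0 * g 1) (g 2))⁻¹ * f (g 0) (g 1 * g 2) *
        (f (g 0) (g 1))⁻¹) := by
  have h3 : ((-1) ^ 3 : ULift.{u} ℤ) = -1 := by ring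
  have h1 : ∀ a : gModule G M, (1 : ULift.{u} ℤ) • a = a := fun a => one_smul _ a
  rw [inhomogeneousCochains.d_hom_apply, Fin.sum_univ_three, gModule_rho_apply]
  simp [Fin.contractNth, toGModule_mul, toGModule_inv, h3, add_assoc]
  repeat erw [h1]

theorem d_three_toGModule (f : G → G → G → M) (g : Fin 4 → G) :
    inhomogeneousCochains.d (gModule G M) 3 (fun h => toGModule (f (h 0) (h 1) (h 2))) g =
      toGModule (g 0 • f (g 1) (g 2) (g 3) * (f (g 0 * g 1) (g 2) (g 3))⁻¹ *
        f (g 0) (g 1 * g 2) (g 3) * (f (g 0) (g 1) (g 2 * g 3))⁻¹ * f (g 0) (g 1) (g 2)) := by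
  have h3 : ((-1) ^ 3 : ULift.{u} ℤ) = -1 := by ring
  have h4 : ((-1) ^ 4 : ULift.{u} ℤ) = 1 := by ring
  have h1 : ∀ a : gModule G M, (1 : ULift.{u} ℤ) • a = a := fun a => one_smul _ a
  rw [inhomogeneousCochains.d_hom_apply, Fin.sum_univ_four, gModule_rho_apply]
  simp [Fin.contractNth, toGModule_mul, toGModule_inv, h3, h4, add_assoc]
  repeat erw [h1]

end Differentials

namespace CrossedTwoFoldExtension

variable {M C Γ G : Type*} [CommGroup M] [Group C] [Group Γ] [Group G]
  [MulDistribMulAction Γ C] [MulDistribMulAction G M]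

/-- Choices that define a 3-cocycle of a crossed 2-fold extension: a section `sec` of
`Γ → G` as a map of sets, and elements `fac x y` of `C` that measure the failure of `sec` to be
multiplicative. -/
structure Lifting (e : CrossedTwoFoldExtension M C Γ G) where
  sec : G → Γ
  proj_sec : ∀ x, e.proj (sec x) = x
  fac : G → G → C
  boundary_fac : ∀ x y, e.boundary (fac x y) * sec (x * y) = sec x * sec y

theorem boundary_eq_one_iff (e : CrossedTwoFoldExtension M C Γ G) (c : C) :
    e.boundary c = 1 ↔ ∃ m, e.incl m = c := by
  rw [← MonoidHom.mem_ker, ← e.range_incl, MonoidHom.mem_range]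

theorem proj_eq_one_iff (e : CrossedTwoFoldExtension M C Γ G) (γ : Γ) :
    e.proj γ = 1 ↔ ∃ c, e.boundary c = γ := by
  rw [← MonoidHom.mem_ker, ← e.range_boundary, MonoidHom.mem_range]

theorem incl_comm (e : CrossedTwoFoldExtension M C Γ G) (m : M) (c : C) :
    e.incl m * c = c * e.incl m := by
  have h := e.peiffer (e.incl m) c
  rw [(e.boundary_eq_one_iff _).2 ⟨m, rfl⟩, one_smul] at h
  exact (eq_mul_inv_iff_mul_eq.1 h).symm

theorem nonempty_lifting (e : CrossedTwoFoldExtension M C Γ G) : Nonempty e.Lifting := by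
  have hs := Function.surjInv_eq e.proj_surjective
  have h : ∀ x y : G, ∃ c, e.boundary c = Function.surjInv e.proj_surjective x *
      Function.surjInv e.proj_surjective y * (Function.surjInv e.proj_surjective (x * y))⁻¹ := by
    intro x y
    rw [← e.proj_eq_one_iff]
    simp [hs]
  choose f hf using h
  exact ⟨⟨_, hs, f, fun x y => by rw [hf, inv_mul_cancel_right]⟩⟩

namespace Lifting

variable {e : CrossedTwoFoldExtension M C Γ G}

theorem exists_cochain (L : e.Lifting) (x y z : G) : ∃ m : M,
    L.sec x • L.fac y z * L.fac x (y * z) = e.incl m * (L.fac x y * L.fac (x * y) z) := by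
  have h : e.boundary (L.sec x • L.fac y z * L.fac x (y * z) *
      (L.fac x y * L.fac (x * y) z)⁻¹) = 1 := by
    have h1 := L.boundary_fac x (y * z)
    have h2 := L.boundary_fac y z
    have h3 := L.boundary_fac x y
    have h4 := L.boundary_fac (x * y) z
    rw [← eq_mul_inv_iff_mul_eq] at h1 h2 h3 h4
    rw [map_mul, map_inv, map_mul, map_mul, e.boundary_smul, h1, h2, h3, h4, mul_assoc x y z]
    group
  obtain ⟨m, hm⟩ := (e.boundary_eq_one_iff _).1 h
  exact ⟨m, by rw [hm, inv_mul_cancel_right]⟩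

/-- The 3-cochain `ξ` of `G` with values in `M` defined by
`ˢ⁽ˣ⁾f(y,z) · f(x,yz) = ξ(x,y,z) · f(x,y) · f(xy,z)`. -/
def cochain (L : e.Lifting) (x y z : G) : M := (L.exists_cochain x y z).choose

theorem cochain_spec (L : e.Lifting) (x y z : G) :
    L.sec x • L.fac y z * L.fac x (y * z) =
      e.incl (L.cochain x y z) * (L.fac x y * L.fac (x * y) z) :=
  (L.exists_cochain x y z).choose_spec

theorem eq_cochain (L : e.Lifting) {x y z : G} {m : M}
    (h : L.sec x • L.fac y z * L.fac x (y * z) = e.incl m * (L.fac x y * L.fac (x * y) z)) :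
    L.cochain x y z = m :=
  e.incl_injective (mul_right_cancel ((L.cochain_spec x y z).symm.trans h))

theorem cochain_cocycle (L : e.Lifting) (x y z w : G) :
    (x • L.cochain y z w) * L.cochain x (y * z) w * L.cochain x y z =
      L.cochain (x * y) z w * L.cochain x y (z * w) := by
  have hx : ∀ m : M, L.sec x • e.incl m = e.incl (x • m) := fun m => by
    rw [← e.incl_smul, L.proj_sec]
  have way1 : L.sec x • (L.sec y • L.fac z w * L.fac y (z * w)) * L.fac x (y * (z * w)) =
      e.incl ((x • L.cochain y z w) * L.cochain x (y * z) w * L.cochain x y z) *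
        (L.fac x y * L.fac (x * y) z * L.fac (x * y * z) w) := by
    rw [L.cochain_spec y z w, smul_mul', smul_mul', hx]
    have h1 := L.cochain_spec x (y * z) w
    have h2 := L.cochain_spec x y z
    rw [show y * (z * w) = y * z * w from (mul_assoc _ _ _).symm, mul_assoc, mul_assoc, h1,
      ← mul_assoc (L.sec x • L.fac y z), ← e.incl_comm, mul_assoc (e.incl _),
      ← mul_assoc (L.sec x • L.fac y z), h2, map_mul, map_mul, ← mul_assoc x y z]
    simp only [mul_assoc]
  have way2 : L.sec x • (L.sec y • L.fac z w * L.fac y (z * w)) * L.fac x (y * (z * w)) =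
      e.incl (L.cochain (x * y) z w * L.cochain x y (z * w)) *
        (L.fac x y * L.fac (x * y) z * L.fac (x * y * z) w) := by
    rw [smul_mul', ← mul_smul, ← L.boundary_fac x y, mul_smul, e.peiffer, mul_assoc,
      L.cochain_spec x y (z * w), mul_assoc, mul_assoc, ← mul_assoc _ (e.incl _), ← e.incl_comm]
    have h1 := L.cochain_spec (x * y) z w
    rw [mul_assoc (e.incl _), ← mul_assoc (L.fac x y)⁻¹ (L.fac x y), inv_mul_cancel, one_mul,
      ← mul_assoc (L.sec (x * y) • _), ← e.incl_comm, mul_assoc (e.incl _), h1,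
      ← mul_assoc (L.fac x y) (e.incl _), ← e.incl_comm, mul_comm (L.cochain (x * y) z w)]
    rw [map_mul, mul_assoc (e.incl _) (L.fac x y), ← mul_assoc (L.fac x y) (e.incl _),
      ← e.incl_comm]
    simp only [mul_assoc]
  exact e.incl_injective (mul_right_cancel (way1.symm.trans way2))

/-- Changing the choices in a crossed 2-fold extension changes the 3-cochain by a coboundary. -/
theorem cochain_change (L L' : e.Lifting) : ∃ c : G → G → M, ∀ x y z,
    L'.cochain x y z * (c x y * c (x * y) z) =
      L.cochain x y z * ((x • c y z) * c x (y * z)) := by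
  have h : ∀ x, ∃ k, e.boundary k = L'.sec x * (L.sec x)⁻¹ := fun x => by
    rw [← e.proj_eq_one_iff]
    simp [proj_sec]
  choose k hk using h
  have hk' : ∀ x, L'.sec x = e.boundary (k x) * L.sec x := fun x => by
    rw [hk, inv_mul_cancel_right]
  have hc : ∀ x y, ∃ c, L'.fac x y =
      e.incl c * (k x * L.sec x • k y * L.fac x y * (k (x * y))⁻¹) := by
    intro x y
    have h1 : e.boundary (L'.fac x y * (k x * L.sec x • k y * L.fac x y * (k (x * y))⁻¹)⁻¹) = 1 := by
      have h1 := L.boundary_fac x y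
      have h2 := L'.boundary_fac x y
      rw [← eq_mul_inv_iff_mul_eq] at h1 h2
      simp only [map_mul, map_inv, e.boundary_smul, h1, h2, hk']
      group
    obtain ⟨c, hc⟩ := (e.boundary_eq_one_iff _).1 h1
    exact ⟨c, by rw [hc, inv_mul_cancel_right]⟩
  choose c hc using hc
  refine ⟨c, fun x y z => ?_⟩
  have hx : ∀ m : M, L'.sec x • e.incl m = e.incl (x • m) := fun m => by
    rw [← e.incl_smul, L'.proj_sec]
  have hxy : L.sec x • L.sec y • k z = L.fac x y * L.sec (x * y) • k z * (L.fac x y)⁻¹ := by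
    rw [← mul_smul, ← L.boundary_fac x y, mul_smul, e.peiffer]
  have main : L'.sec x • (k y * L.sec y • k z * L.fac y z * (k (y * z))⁻¹) *
      (k x * L.sec x • k (y * z) * L.fac x (y * z) * (k (x * (y * z)))⁻¹) =
      e.incl (L.cochain x y z) * ((k x * L.sec x • k y * L.fac x y * (k (x * y))⁻¹) *
        (k (x * y) * L.sec (x * y) • k z * L.fac (x * y) z * (k (x * y * z))⁻¹)) := by
    have h0 : e.incl (L.cochain x y z) =
        L.sec x • L.fac y z * L.fac x (y * z) * (L.fac x y * L.fac (x * y) z)⁻¹ :=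
      eq_mul_inv_of_mul_eq (L.cochain_spec x y z).symm
    have h1 : L.sec x • L.fac y z * L.fac x (y * z) =
        L.fac x y * e.incl (L.cochain x y z) * L.fac (x * y) z := by
      rw [L.cochain_spec, ← e.incl_comm, mul_assoc]
    rw [hk', mul_smul, e.peiffer]
    simp only [smul_mul', smul_inv', hxy]
    have lhs : ∀ p q r s t u v : C, p * (q * r * s * (t)⁻¹) * p⁻¹ * (p * t * u * v) =
        p * q * r * (s * u) * v := fun p q r s t u v => by group
    rw [lhs, h1, mul_assoc x y z]
    have rhs : ∀ p q r s t u v : C, p * q * r * s⁻¹ * (s * t * u * v) =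
        p * q * r * t * u * v := fun p q r s t u v => by group
    rw [rhs]
    have r2 : ∀ p q r s t u : C, p * q * (r * s * r⁻¹) * (r * t * u) =
        (p * q * r * s) * t * u := fun p q r s t u => by group
    rw [r2, ← e.incl_comm]
    simp only [mul_assoc]
  have h := L'.cochain_spec x y z
  rw [hc y z, hc x (y * z), hc x y, hc (x * y) z, smul_mul', hx] at h
  refine e.incl_injective ?_
  have cm : ∀ (m n : M) (a b : C), e.incl m * a * (e.incl n * b) = e.incl (m * n) * (a * b) :=
    fun m n a b => by
      rw [mul_assoc, ← mul_assoc a, ← e.incl_comm, map_mul]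
      simp only [mul_assoc]
  rw [cm, cm, main, ← mul_assoc, ← mul_assoc (e.incl _) (e.incl _), ← map_mul, ← map_mul] at h
  have h' := mul_right_cancel h
  rw [← h', mul_comm]


end Lifting

end CrossedTwoFoldExtension

namespace CrossedTwoFoldExtension

variable {G M : Type u} {C Γ : Type*} [CommGroup M] [Group C] [Group Γ] [Group G]
  [MulDistribMulAction Γ C] [MulDistribMulAction G M] {e : CrossedTwoFoldExtension M C Γ G}

/-- The 3-cocycle of a lifting as an inhomogeneous 3-cochain. -/
def Lifting.cochain3 (L : e.Lifting) : (Fin 3 → G) → gModule G M :=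
  fun g => toGModule (L.cochain (g 0) (g 1) (g 2))

theorem Lifting.d_cochain3 (L : e.Lifting) :
    inhomogeneousCochains.d (gModule G M) 3 L.cochain3 = 0 := by
  funext g
  refine (d_three_toGModule L.cochain g).trans ?_
  refine (congrArg toGModule ?_ : _ = (toGModule (1 : M) : gModule G M))
  rw [mul_right_comm _ _ (L.cochain (g 0) (g 1 * g 2) (g 3)), mul_right_comm _ _ (L.cochain _ _ _),
    mul_right_comm _ _ (L.cochain _ _ _), L.cochain_cocycle]
  simp [mul_comm]

/-- The class in `H³(G, M)` of the 3-cocycle of a lifting. -/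
def Lifting.cohomologyClass (L : e.Lifting) : H3 G M :=
  groupCohomology.π (gModule G M) 3 (groupCohomology.cocyclesMk L.cochain3 L.d_cochain3)

/-- The class in `H³(G, M)` represented by a crossed 2-fold extension. -/
def cohomologyClass (e : CrossedTwoFoldExtension M C Γ G) : H3 G M :=
  e.nonempty_lifting.some.cohomologyClass

/-- The class in `H³(G, M)` does not depend on the choices. -/
theorem Lifting.cohomologyClass_eq (L : e.Lifting) : L.cohomologyClass = e.cohomologyClass := by
  suffices h : ∀ L L' : e.Lifting, L.cohomologyClass = L'.cohomologyClass from h _ _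
  intro L L'
  obtain ⟨c, hc⟩ := L'.cochain_change L
  have hd : L.cochain3 = L'.cochain3 +
      inhomogeneousCochains.d (gModule G M) 2 (fun h => toGModule (c (h 0) (h 1))) := by
    funext g
    rw [Pi.add_apply, d_two_toGModule]
    unfold cochain3
    rw [← toGModule_mul]
    congr 1
    have h := hc (g 0) (g 1) (g 2)
    rw [← eq_mul_inv_iff_mul_eq] at h
    rw [h, mul_inv]
    simp only [mul_assoc, mul_left_comm, mul_comm]
  have hz : groupCohomology.cocyclesMk L.cochain3 L.d_cochain3 =
      groupCohomology.cocyclesMk L'.cochain3 L'.d_cochain3 +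
        groupCohomology.toCocycles (gModule G M) 2 3 (fun h => toGModule (c (h 0) (h 1))) := by
    apply (ModuleCat.mono_iff_injective (groupCohomology.iCocycles (gModule G M) 3)).1 inferInstance
    rw [map_add, groupCohomology.iCocycles_mk, groupCohomology.iCocycles_mk, hd]
    congr 1
    rw [← ModuleCat.comp_apply, HomologicalComplex.toCycles_i,
      groupCohomology.inhomogeneousCochains.d_def]
  unfold Lifting.cohomologyClass
  rw [hz, map_add, ← ModuleCat.comp_apply]
  erw [HomologicalComplex.toCycles_comp_homologyπ]
  exact add_zero _

end CrossedTwoFoldExtension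

/-! ## Outer automorphisms and normal algebras

A central `S`-algebra `A` is an `S`-algebra with `[FaithfulSMul S A]` (that is, `S → A` is
injective) and `[Algebra.IsCentral S A]`: the center of `A` is the image of `S`. The group of ring
automorphisms of `A` is `RingAut A`, and an action of `Q` on `S` is a `MulSemiringAction Q S`. -/

section Outer

variable (A : Type*) [Ring A]

/-- The homomorphism that sends a unit to the inner automorphism `a ↦ u a u⁻¹`. -/
def innerHom : Aˣ →* RingAut A where
  toFun u :=
    { toFun := fun a => u * a * ↑u⁻¹
      invFun := fun a => ↑u⁻¹ * a * u
      left_inv := fun a => by simp [mul_assoc]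
      right_inv := fun a => by simp [mul_assoc]
      map_mul' := fun a b => by simp [mul_assoc]
      map_add' := fun a b => by simp [mul_add, add_mul] }
  map_one' := by ext a; simp
  map_mul' u v := by ext a; simp [mul_assoc]

variable {A}

theorem innerHom_apply (u : Aˣ) (a : A) : innerHom A u a = u * a * ↑u⁻¹ := rfl

theorem innerHom_smul (α : RingAut A) (u : Aˣ) :
    innerHom A (α • u) = α * innerHom A u * α⁻¹ := by
  ext a
  have hv : (((α • u)⁻¹ : Aˣ) : A) = α ((u⁻¹ : Aˣ) : A) := by
    rw [← smul_inv', Units.coe_smul, RingAut.smul_def]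
  simp [innerHom_apply, hv]

variable (A)

/-- The group of inner automorphisms. -/
def Inn : Subgroup (RingAut A) := (innerHom A).range

instance Inn.normal : (Inn A).Normal where
  conj_mem := by
    rintro _ ⟨u, rfl⟩ α
    exact ⟨α • u, innerHom_smul α u⟩

/-- Ring automorphisms modulo inner automorphisms. -/
abbrev Out : Type _ := RingAut A ⧸ Inn A

variable {A}

theorem Out.mk_eq_one_iff (α : RingAut A) :
    (QuotientGroup.mk' (Inn A) α) = 1 ↔ ∃ u, innerHom A u = α :=
  QuotientGroup.eq_one_iff α

end Outer

section Restriction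

variable (S A : Type*) [CommRing S] [Ring A] [Algebra S A] [FaithfulSMul S A]
  [Algebra.IsCentral S A]

/-- The identification of `S` with the center of a central `S`-algebra. -/
def centerEquiv : S ≃+* Subring.center A :=
  RingEquiv.ofBijective
    ((algebraMap S A).codRestrict (Subring.center A) fun s =>
      Subring.mem_center_iff.2 fun a => (Algebra.commutes s a).symm)
    ⟨fun _ _ h => FaithfulSMul.algebraMap_injective S A (congrArg Subtype.val h),
     fun z => by
      obtain ⟨s, hs⟩ := Algebra.mem_bot.1 (Algebra.IsCentral.out (K := S) (D := A)
        (Subalgebra.mem_center_iff.2 (Subring.mem_center_iff.1 z.2)))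
      exact ⟨s, Subtype.ext hs⟩⟩

/-- Restriction of automorphisms to the center, `Aut(A) → Aut(S)`. -/
def restrictHom : RingAut A →* RingAut S where
  toFun α := ((centerEquiv S A).trans (Subring.centerCongr α)).trans (centerEquiv S A).symm
  map_one' := by
    ext s
    exact (centerEquiv S A).symm_apply_apply s
  map_mul' α β := by
    ext s
    change (centerEquiv S A).symm _ = (centerEquiv S A).symm (Subring.centerCongr α
      ((centerEquiv S A) ((centerEquiv S A).symm _)))
    rw [RingEquiv.apply_symm_apply]
    rfl

variable {S A}

theorem algebraMap_restrictHom (α : RingAut A) (s : S) :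
    algebraMap S A (restrictHom S A α s) = α (algebraMap S A s) :=
  congrArg Subtype.val ((centerEquiv S A).apply_symm_apply
    (Subring.centerCongr α (centerEquiv S A s)))

theorem restrictHom_eq_iff (α : RingAut A) (φ : RingAut S) :
    restrictHom S A α = φ ↔ ∀ s, α (algebraMap S A s) = algebraMap S A (φ s) := by
  simp_rw [← algebraMap_restrictHom, (FaithfulSMul.algebraMap_injective S A).eq_iff]
  exact RingEquiv.ext_iff

variable (S A)

/-- The restriction map `Out(A) → Aut(S)`. -/
def Out.res : Out A →* RingAut S :=
  QuotientGroup.lift (Inn A) (restrictHom S A) (by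
    rintro _ ⟨u, rfl⟩
    rw [MonoidHom.mem_ker, restrictHom_eq_iff]
    intro s
    rw [innerHom_apply, ← Algebra.commutes, mul_assoc, Units.mul_inv, mul_one]
    rfl)

theorem Out.res_mk (α : RingAut A) :
    Out.res S A (QuotientGroup.mk' (Inn A) α) = restrictHom S A α := rfl

end Restriction

/-- A `Q`-normal structure on the central `S`-algebra `A`: a homomorphism `Q → Out(A)` that lifts
the action of `Q` on `S`. -/
structure QNormalStructure (Q S A : Type*) [Group Q] [CommRing S] [MulSemiringAction Q S] [Ring A]
    [Algebra S A] [FaithfulSMul S A] [Algebra.IsCentral S A] where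
  toHom : Q →* Out A
  res_toHom : (Out.res S A).comp toHom = MulSemiringAction.toRingAut Q S

/-- A `Q`-equivariant structure on the central `S`-algebra `A`: an action of `Q` on `A` by ring
automorphisms that induces the given action of `Q` on `S`. -/
structure QEquivariantStructure (Q S A : Type*) [Group Q] [CommRing S] [MulSemiringAction Q S]
    [Ring A] [Algebra S A] [FaithfulSMul S A] [Algebra.IsCentral S A] where
  toHom : Q →* RingAut A
  restrict_toHom : (restrictHom S A).comp toHom = MulSemiringAction.toRingAut Q S

/-- The `Q`-normal structure induced by a `Q`-equivariant structure. -/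
def QEquivariantStructure.toQNormalStructure {Q S A : Type*} [Group Q] [CommRing S]
    [MulSemiringAction Q S] [Ring A] [Algebra S A] [FaithfulSMul S A] [Algebra.IsCentral S A]
    (τ : QEquivariantStructure Q S A) : QNormalStructure Q S A where
  toHom := (QuotientGroup.mk' (Inn A)).comp τ.toHom
  res_toHom := τ.restrict_toHom

namespace QNormalStructure

section Teichmuller

variable {Q S A : Type*} [Group Q] [CommRing S] [MulSemiringAction Q S] [Ring A]
  [Algebra S A] [FaithfulSMul S A] [Algebra.IsCentral S A]

/-- A `Q`-normal structure is equivariant if it arises from an action of `Q` on `A` by ring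
automorphisms. -/
def IsEquivariant (σ : QNormalStructure Q S A) : Prop :=
  ∃ τ : QEquivariantStructure Q S A, τ.toQNormalStructure = σ

/-- The fiber product group `B^σ = Aut(A) ×_{Out(A)} Q`. -/
def fiberProduct (σ : QNormalStructure Q S A) : Subgroup (RingAut A × Q) :=
  ((QuotientGroup.mk' (Inn A)).comp (MonoidHom.fst (RingAut A) Q)).eqLocus
    (σ.toHom.comp (MonoidHom.snd (RingAut A) Q))

/-- `B^σ` acts on the units of `A` through the projection to `Aut(A)`. -/
instance (σ : QNormalStructure Q S A) : MulDistribMulAction σ.fiberProduct Aˣ :=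
  MulDistribMulAction.compHom Aˣ ((MonoidHom.fst (RingAut A) Q).comp σ.fiberProduct.subtype)

theorem fiberProduct_smul_def (σ : QNormalStructure Q S A) (b : σ.fiberProduct) (u : Aˣ) :
    b • u = b.1.1 • u := rfl

theorem apply_algebraMap (σ : QNormalStructure Q S A) {α : RingAut A} {q : Q}
    (h : QuotientGroup.mk' (Inn A) α = σ.toHom q) (s : S) :
    α (algebraMap S A s) = algebraMap S A (q • s) := by
  have h1 := DFunLike.congr_fun σ.res_toHom q
  rw [MonoidHom.comp_apply, ← h, Out.res_mk, restrictHom_eq_iff] at h1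
  exact h1 s

/-- The crossed 2-fold extension `1 → U(S) → U(A) → B^σ → Q → 1` of a `Q`-normal algebra. -/
def teichmullerComplex (σ : QNormalStructure Q S A) :
    CrossedTwoFoldExtension Sˣ Aˣ σ.fiberProduct Q where
  boundary := ((innerHom A).prod 1).codRestrict σ.fiberProduct fun u => by
    change QuotientGroup.mk' (Inn A) (innerHom A u) = σ.toHom 1
    rw [map_one, Out.mk_eq_one_iff]
    exact ⟨u, rfl⟩
  boundary_smul b u := by
    refine Subtype.ext (Prod.ext (innerHom_smul b.1.1 u) ?_)
    change (1 : Q) = b.1.2 * 1 * b.1.2⁻¹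
    simp
  peiffer u v := Units.ext rfl
  incl := Units.map (algebraMap S A : S →* A)
  incl_injective := Units.map_injective (FaithfulSMul.algebraMap_injective S A)
  range_incl := by
    ext u
    rw [MonoidHom.mem_range, MonoidHom.mem_ker]
    constructor
    · rintro ⟨s, rfl⟩
      refine Subtype.ext (Prod.ext (RingEquiv.ext fun a => ?_) rfl)
      change algebraMap S A s * a * ↑(Units.map (algebraMap S A : S →* A) s)⁻¹ = a
      rw [Algebra.commutes, mul_assoc]
      exact (congrArg (a * ·) (Units.mul_inv (Units.map (algebraMap S A : S →* A) s))).trans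
        (mul_one a)
    · intro h
      have h1 : ∀ a : A, (u : A) * a * ↑u⁻¹ = a := fun a =>
        DFunLike.congr_fun (congrArg (fun b => b.1.1) h) a
      have hc : ∀ a : A, (u : A) * a = a * u := fun a => by
        rw [← Units.mul_inv_eq_iff_eq_mul]
        exact h1 a
      have hc' : ∀ a : A, ((u⁻¹ : Aˣ) : A) * a = a * ((u⁻¹ : Aˣ) : A) := fun a => by
        rw [Units.inv_mul_eq_iff_eq_mul, ← mul_assoc, hc, mul_assoc, Units.mul_inv, mul_one]
      have hm : ∀ v : A, (∀ a, v * a = a * v) → ∃ s : S, algebraMap S A s = v := fun v hv =>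
        Algebra.mem_bot.1 (Algebra.IsCentral.out (K := S) (D := A)
          (Subalgebra.mem_center_iff.2 fun a => (hv a).symm))
      obtain ⟨s, hs⟩ := hm u hc
      obtain ⟨t, ht⟩ := hm _ hc'
      have inj := FaithfulSMul.algebraMap_injective S A
      exact ⟨⟨s, t, inj (by simp [hs, ht]), inj (by simp [hs, ht])⟩, Units.ext hs⟩
  proj := (MonoidHom.snd (RingAut A) Q).comp σ.fiberProduct.subtype
  range_boundary := by
    ext b
    rw [MonoidHom.mem_range, MonoidHom.mem_ker]
    constructor
    · rintro ⟨u, rfl⟩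
      rfl
    · intro h
      have h1 : b.1.2 = 1 := h
      have h2 : QuotientGroup.mk' (Inn A) b.1.1 = σ.toHom b.1.2 := b.2
      rw [h1, map_one, Out.mk_eq_one_iff] at h2
      obtain ⟨u, hu⟩ := h2
      exact ⟨u, Subtype.ext (Prod.ext hu h1.symm)⟩
  proj_surjective q := by
    obtain ⟨α, hα⟩ := QuotientGroup.mk'_surjective (Inn A) (σ.toHom q)
    exact ⟨⟨(α, q), hα⟩, rfl⟩
  incl_smul b s := Units.ext (σ.apply_algebraMap b.2 s).symm

end Teichmuller

/-- The Teichmüller class of a `Q`-normal algebra, an element of `H³(Q, U(S))`. -/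
def teichmullerClass {Q S : Type u} {A : Type*} [Group Q] [CommRing S] [MulSemiringAction Q S]
    [Ring A] [Algebra S A] [FaithfulSMul S A] [Algebra.IsCentral S A]
    (σ : QNormalStructure Q S A) : H3 Q Sˣ :=
  σ.teichmullerComplex.cohomologyClass

end QNormalStructure

/-! ## Matrix algebras -/

/-- The matrix algebra `M_I(A)` for a possibly infinite index set `I`: the ring of endomorphisms of
the direct sum of `I` copies of `A`, as a left module over `Aᵐᵒᵖ` (that is, a right `A`-module).
For finite `I` this is the ring of `I × I`-matrices over `A`. -/
abbrev MatrixAlgebra (I A : Type*) [Ring A] : Type _ := Module.End Aᵐᵒᵖ (I →₀ A)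

namespace MatrixAlgebra

section

variable (S I A : Type*) [CommRing S] [Ring A] [Algebra S A]

instance faithfulSMul [Nonempty I] [FaithfulSMul S A] : FaithfulSMul S (MatrixAlgebra I A) where
  eq_of_smul_eq_smul {s t} h := by
    obtain ⟨i⟩ := ‹Nonempty I›
    refine eq_of_smul_eq_smul (α := A) fun a => ?_
    have h1 := DFunLike.congr_fun (DFunLike.congr_fun (h 1) (Finsupp.single i a)) i
    simpa using h1

instance isCentral [Nonempty I] [Algebra.IsCentral S A] :
    Algebra.IsCentral S (MatrixAlgebra I A) where
  out f hf := by
    obtain ⟨i⟩ := ‹Nonempty I›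
    rw [Subalgebra.mem_center_iff] at hf
    have key : ∀ v : I →₀ A, f v = MulOpposite.op (f (Finsupp.single i 1) i) • v := by
      intro v
      let g : MatrixAlgebra I A :=
        { toFun := fun x => MulOpposite.op (x i) • v
          map_add' := fun x y => by simp [add_smul]
          map_smul' := fun c x => by simp [mul_smul] }
      have h := LinearMap.congr_fun (hf g) (Finsupp.single i 1)
      have h1 : g (Finsupp.single i 1) = v := by simp [g]
      rw [Module.End.mul_apply, Module.End.mul_apply, h1] at h
      exact h.symm
    have hc : ∀ a : A, a * f (Finsupp.single i 1) i = f (Finsupp.single i 1) i * a := by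
      intro a
      have h1 := key (MulOpposite.op a • Finsupp.single i 1)
      rw [map_smul] at h1
      have h2 := DFunLike.congr_fun h1 i
      simpa using h2.symm
    obtain ⟨s, hs⟩ := Algebra.mem_bot.1 (Algebra.IsCentral.out (K := S) (D := A)
      (Subalgebra.mem_center_iff.2 hc))
    refine Algebra.mem_bot.2 ⟨s, LinearMap.ext fun v => ?_⟩
    rw [key, ← hs]
    ext j
    change s • v j = v j * algebraMap S A s
    rw [Algebra.smul_def, Algebra.commutes]

end

section

variable (I : Type*) {A : Type*} [Ring A]

theorem smul_op_smul (α : RingAut A) (c : Aᵐᵒᵖ) (x : I →₀ A) :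
    α • c • x = MulOpposite.op (α c.unop) • α • x := by
  ext i
  exact map_mul α (x i) c.unop

/-- The automorphism `f ↦ α ∘ f ∘ α⁻¹` of `M_I(A)` induced by an automorphism `α` of `A`, where `α`
acts on `⨁_I A` coordinatewise; on matrices it applies `α` to each entry. -/
def mapAut : RingAut A →* RingAut (MatrixAlgebra I A) where
  toFun α :=
    { toFun := fun f =>
        { toFun := fun x => α • f (α⁻¹ • x)
          map_add' := fun x y => by simp only [smul_add, map_add]
          map_smul' := fun c x => by
            rw [smul_op_smul, map_smul, smul_op_smul]
            exact congrArg (fun a => MulOpposite.op a • α • f (α⁻¹ • x))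
              (α.apply_symm_apply c.unop) }
      invFun := fun f =>
        { toFun := fun x => α⁻¹ • f (α • x)
          map_add' := fun x y => by simp only [smul_add, map_add]
          map_smul' := fun c x => by
            rw [smul_op_smul, map_smul, smul_op_smul]
            exact congrArg (fun a => MulOpposite.op a • α⁻¹ • f (α • x))
              (α.symm_apply_apply c.unop) }
      left_inv := fun f => LinearMap.ext fun x => by simp
      right_inv := fun f => LinearMap.ext fun x => by simp
      map_mul' := fun f g => LinearMap.ext fun x => by simp
      map_add' := fun f g => LinearMap.ext fun x => by simp }
  map_one' := RingEquiv.ext fun f => LinearMap.ext fun x => by simp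
  map_mul' α β := RingEquiv.ext fun f => LinearMap.ext fun x => by simp [mul_smul]

variable {I}

theorem mapAut_apply (α : RingAut A) (f : MatrixAlgebra I A) (x : I →₀ A) :
    mapAut I α f x = α • f (α⁻¹ • x) := rfl

variable (I)

/-- The scalar matrix of an element of `A`. -/
def scalar : A →+* MatrixAlgebra I A := Module.toModuleEnd Aᵐᵒᵖ (I →₀ A)

theorem scalar_apply (a : A) (x : I →₀ A) : scalar I a x = a • x := rfl

theorem mapAut_innerHom (u : Aˣ) :
    mapAut I (innerHom A u) = innerHom (MatrixAlgebra I A) 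
      (Units.map ((scalar I : A →+* MatrixAlgebra I A) : A →* MatrixAlgebra I A) u) := by
  refine RingEquiv.ext fun f => LinearMap.ext fun x => ?_
  have h : ∀ (v : Aˣ) (y : I →₀ A), innerHom A v • y =
      MulOpposite.op (↑v⁻¹ : A) • (v : A) • y := fun v y => by
    ext i
    rfl
  rw [mapAut_apply, ← map_inv, h, h, map_smul, innerHom_apply]
  change _ = (u : A) • f (((u⁻¹ : Aˣ) : A) • x)
  ext i
  simp [mul_assoc]

/-- The homomorphism `Out(A) → Out(M_I(A))` induced by `Aut(A) → Aut(M_I(A))`. -/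
def mapOut : Out A →* Out (MatrixAlgebra I A) :=
  QuotientGroup.map (Inn A) (Inn (MatrixAlgebra I A)) (mapAut I) (by
    rintro _ ⟨u, rfl⟩
    exact ⟨_, (mapAut_innerHom I u).symm⟩)

end

end MatrixAlgebra

/-- The `Q`-normal structure `σ_I` on the matrix algebra `M_I(A)` determined by a `Q`-normal
structure `σ` on `A`. -/
def QNormalStructure.matrix {Q S A : Type*} [Group Q] [CommRing S] [MulSemiringAction Q S]
    [Ring A] [Algebra S A] [FaithfulSMul S A] [Algebra.IsCentral S A]
    (σ : QNormalStructure Q S A) (I : Type*) [Nonempty I] :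
    QNormalStructure Q S (MatrixAlgebra I A) where
  toHom := (MatrixAlgebra.mapOut I).comp σ.toHom
  res_toHom := by
    refine MonoidHom.ext fun q => ?_
    obtain ⟨α, hα⟩ := QuotientGroup.mk'_surjective (Inn A) (σ.toHom q)
    rw [MonoidHom.comp_apply, MonoidHom.comp_apply, ← hα]
    change restrictHom S (MatrixAlgebra I A) (MatrixAlgebra.mapAut I α) = _
    rw [restrictHom_eq_iff]
    intro s
    refine LinearMap.ext fun x => ?_
    rw [MatrixAlgebra.mapAut_apply, Module.algebraMap_end_apply, Module.algebraMap_end_apply]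
    ext i
    have h := σ.apply_algebraMap hα s
    have h2 : α (α⁻¹ (x i)) = x i := α.apply_symm_apply (x i)
    change α (s • α⁻¹ (x i)) = (q • s) • x i
    rw [Algebra.smul_def, map_mul, h, h2, Algebra.smul_def]

/-! ## Galois extensions and scalar extension -/

section Galois

variable (Q S : Type*) [Group Q] [CommRing S] [MulSemiringAction Q S]

/-- The subring `S^Q` of elements fixed by `Q`. -/
def fixedSubring : Subring S where
  carrier := {s | ∀ q : Q, q • s = s}
  mul_mem' ha hb q := by rw [smul_mul', ha q, hb q]
  one_mem' q := smul_one q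
  add_mem' ha hb q := by rw [smul_add, ha q, hb q]
  zero_mem' q := smul_zero q
  neg_mem' ha q := by rw [smul_neg, ha q]

instance : SMulCommClass Q (fixedSubring Q S) S where
  smul_comm q r s := by
    rw [Subring.smul_def, Subring.smul_def, smul_eq_mul, smul_eq_mul, smul_mul', r.2 q]

/-- The map `h : S ⊗_R S → Map(Q, S)`, `h(s ⊗ t)(q) = s · q(t)`, with `R = S^Q`. -/
def galoisMap : S ⊗[fixedSubring Q S] S →ₗ[fixedSubring Q S] (Q → S) :=
  TensorProduct.lift (LinearMap.mk₂ (fixedSubring Q S) (fun s t q => s * q • t)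
    (fun _ _ _ => funext fun _ => add_mul _ _ _)
    (fun _ _ _ => funext fun _ => smul_mul_assoc _ _ _)
    (fun _ _ _ => funext fun _ => by rw [smul_add, mul_add]; rfl)
    (fun _ _ _ => funext fun _ => by rw [smul_comm, mul_smul_comm]; rfl))

/-- `S` is a Galois extension of `R = S^Q` with Galois group `Q`: the group `Q` is finite and acts
faithfully on `S`, and `S ⊗_R S → Map(Q, S)` is an isomorphism. -/
structure IsGaloisExtension : Prop where
  finite : Finite Q
  faithful : FaithfulSMul Q S
  bijective : Function.Bijective (galoisMap Q S)

variable {Q}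

/-- The action of `q ∈ Q` on `S ⊗_R B` induced by the action on `S`, with `R = S^Q`. -/
def scalarExtensionAut (B : Type*) [Ring B] [Algebra (fixedSubring Q S) B] (q : Q) :
    S ⊗[fixedSubring Q S] B ≃+* S ⊗[fixedSubring Q S] B :=
  (Algebra.TensorProduct.congr (MulSemiringAction.toAlgEquiv (fixedSubring Q S) S q)
    (AlgEquiv.refl : B ≃ₐ[fixedSubring Q S] B)).toRingEquiv

end Galois

/-- The `Q`-normal structure `σ` on `A` arises by scalar extension: for some central
`S^Q`-algebra `B`, there is an isomorphism `e : S ⊗ B ≃ A` of `S`-algebras such that `σ(q)` is the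
class of the automorphism of `A` that corresponds to the action of `q` on `S ⊗ B`. -/
def QNormalStructure.ArisesByScalarExtension {Q S : Type*} {A : Type v} [Group Q] [CommRing S]
    [MulSemiringAction Q S] [Ring A] [Algebra S A] [FaithfulSMul S A] [Algebra.IsCentral S A]
    (σ : QNormalStructure Q S A) : Prop :=
  ∃ (B : Type v) (_ : Ring B) (_ : Algebra (fixedSubring Q S) B)
    (_ : FaithfulSMul (fixedSubring Q S) B) (_ : Algebra.IsCentral (fixedSubring Q S) B)
    (e : S ⊗[fixedSubring Q S] B ≃ₐ[S] A), ∀ q : Q,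
      σ.toHom q = QuotientGroup.mk' (Inn A)
        ((e.symm.toRingEquiv.trans (scalarExtensionAut S B q)).trans e.toRingEquiv)

end

/-!
The class of a crossed 2-fold extension vanishes if and only if some choice of a section
`x ↦ α_x` and of factors `f(x, y)` gives the trivial 3-cocycle
(`CrossedTwoFoldExtension.cohomologyClass_eq_zero_iff`). For the Teichmüller class this means that
`α_x α_y = Inn(f(x, y)) α_{xy}` and `α_x(f(y, z)) f(x, yz) = f(x, y) f(xy, z)`, which is what is
needed to form the crossed product `E = ⨁_q A e_q` with `e_x e_y = f(x, y) e_{xy}` and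
`e_x a = α_x(a) e_x`. As a right `A`-module `E` is free on the `e_q`, so that `M_Q(A) = End(E_A)`,
and `Q` acts on `End(E_A)`: `x` sends `g` to `v ↦ g(v e_x) e_x⁻¹`. This is multiplicative in `x`
since `g` commutes with right multiplication by `A`, and it induces `σ_Q`
(`QNormalStructure.isEquivariant_matrix_of_cochain_eq_one`).

Conversely an action of `Q` is a multiplicative section and gives the zero class, and the passage
from `A` to `M_I(A)` does not change the class (`QNormalStructure.teichmullerClass_matrix`), because
scalar matrices and entrywise automorphisms map the crossed 2-fold extension of `A` to that of
`M_I(A)` and are the identity on `U(S)` and on `Q`.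

For a Galois extension, a `Q`-normal algebra is equivariant if and only if it arises by scalar
extension. One direction reads off the action; the other is Galois descent for the fixed subalgebra
(`descentHom_bijective`), where an explicit inverse of `S ⊗_R A^Q → A` comes from elements with
`∑ xᵢ q(yᵢ) = δ_{q,1}`. As `Q` is finite, the first part provides a matrix algebra to which this
applies.
-/

noncomputable section

/-! ### Vanishing of the class of a crossed 2-fold extension -/

namespace CrossedTwoFoldExtension

section

variable {M C Γ G : Type*} [CommGroup M] [Group C] [Group Γ] [Group G]
  [MulDistribMulAction Γ C] [MulDistribMulAction G M] {e : CrossedTwoFoldExtension M C Γ G}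

/-- A lifting stays a lifting when its factors are multiplied by elements of `M`. -/
def Lifting.twist (L : e.Lifting) (c : G → G → M) : e.Lifting where
  sec := L.sec
  proj_sec := L.proj_sec
  fac x y := e.incl (c x y) * L.fac x y
  boundary_fac x y := by
    rw [map_mul, (e.boundary_eq_one_iff _).2 ⟨_, rfl⟩, one_mul, L.boundary_fac]

theorem Lifting.cochain_twist (L : e.Lifting) (c : G → G → M) (x y z : G) :
    (L.twist c).cochain x y z * (c x y * c (x * y) z) =
      L.cochain x y z * ((x • c y z) * c x (y * z)) := by
  have hx : ∀ m : M, L.sec x • e.incl m = e.incl (x • m) := fun m => by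
    rw [← e.incl_smul, L.proj_sec]
  have cm : ∀ (m n : M) (a b : C), e.incl m * a * (e.incl n * b) = e.incl (m * n) * (a * b) :=
    fun m n a b => by
      rw [mul_assoc, ← mul_assoc a, ← e.incl_comm, map_mul]
      simp only [mul_assoc]
  have h := (L.twist c).cochain_spec x y z
  change L.sec x • (e.incl (c y z) * L.fac y z) * (e.incl (c x (y * z)) * L.fac x (y * z)) =
    e.incl _ * (e.incl (c x y) * L.fac x y * (e.incl (c (x * y) z) * L.fac (x * y) z)) at h
  rw [smul_mul', hx, cm, cm, L.cochain_spec, ← mul_assoc, ← mul_assoc (e.incl _) (e.incl _),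
    ← map_mul, ← map_mul] at h
  rw [← e.incl_injective (mul_right_cancel h), mul_comm]

end

variable {G M : Type u} {C Γ : Type*} [CommGroup M] [Group C] [Group Γ] [Group G]
  [MulDistribMulAction Γ C] [MulDistribMulAction G M] {e : CrossedTwoFoldExtension M C Γ G}

/-- A cocycle of positive degree whose class vanishes is a coboundary of inhomogeneous cochains. -/
theorem exists_d_eq_of_π_eq_zero {k : Type u} [CommRing k] (V : Rep.{u} k G) (n : ℕ)
    (f : (Fin (n + 1) → G) → V) (h : inhomogeneousCochains.d V (n + 1) f = 0)
    (h0 : groupCohomology.π V (n + 1) (groupCohomology.cocyclesMk f h) = 0) :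
    ∃ φ : (Fin n → G) → V, inhomogeneousCochains.d V n φ = f := by
  let K := groupCohomology.inhomogeneousCochains V
  have hex : (CategoryTheory.ShortComplex.mk (K.toCycles n (n + 1)) (K.homologyπ (n + 1))
      (K.toCycles_comp_homologyπ n (n + 1))).Exact :=
    CategoryTheory.ShortComplex.exact_of_g_is_cokernel _
      (K.homologyIsCokernel n (n + 1) (by simp))
  obtain ⟨φ, hφ⟩ := (CategoryTheory.ShortComplex.moduleCat_exact_iff _).1 hex _ h0
  refine ⟨φ, ?_⟩
  have h2 := congrArg (groupCohomology.iCocycles V (n + 1)) hφ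
  rw [groupCohomology.iCocycles_mk] at h2
  rw [← h2]
  change _ = groupCohomology.iCocycles V (n + 1) (groupCohomology.toCocycles V n (n + 1) φ)
  rw [← ModuleCat.comp_apply, HomologicalComplex.toCycles_i,
      groupCohomology.inhomogeneousCochains.d_def]

/-- The class of a crossed 2-fold extension vanishes exactly when the choices of section and factors
can be made so that the 3-cocycle is trivial: a cochain that bounds it is absorbed by the
factors. -/
theorem cohomologyClass_eq_zero_iff :
    e.cohomologyClass = 0 ↔ ∃ L : e.Lifting, ∀ x y z, L.cochain x y z = 1 := by
  constructor
  · intro h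
    obtain ⟨L⟩ := e.nonempty_lifting
    rw [← L.cohomologyClass_eq] at h
    obtain ⟨φ, hφ⟩ := exists_d_eq_of_π_eq_zero (gModule G M) 2 _ L.d_cochain3 h
    let c : G → G → M := fun x y => Additive.toMul (φ ![x, y])
    have hc : φ = fun h => toGModule (c (h 0) (h 1)) := by
      funext h
      have : h = ![h 0, h 1] := by
        funext i
        fin_cases i <;> rfl
      rw [this]
      rfl
    refine ⟨L.twist fun x y => (c x y)⁻¹, fun x y z => ?_⟩
    have h1 := congrFun hφ ![x, y, z]
    rw [hc, d_two_toGModule] at h1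
    have h2 : x • c y z * (c (x * y) z)⁻¹ * c x (y * z) * (c x y)⁻¹ = L.cochain x y z := h1
    have h3 := L.cochain_twist (fun x y => (c x y)⁻¹) x y z
    rw [← h2, smul_inv'] at h3
    refine mul_right_cancel (h3.trans ?_)
    rw [one_mul]
    have key : ∀ p q r s : M, p * q⁻¹ * r * s⁻¹ * (p⁻¹ * r⁻¹) = s⁻¹ * q⁻¹ := fun p q r s => by
      rw [mul_comm p⁻¹, ← mul_assoc, mul_right_comm _ s⁻¹, mul_inv_cancel_right,
        mul_comm p, mul_right_comm, mul_inv_cancel_right, mul_comm]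
    exact key _ _ _ _
  · rintro ⟨L, hL⟩
    rw [← L.cohomologyClass_eq]
    unfold Lifting.cohomologyClass
    convert map_zero (groupCohomology.π (gModule G M) 3).hom
    apply (ModuleCat.mono_iff_injective (groupCohomology.iCocycles (gModule G M) 3)).1 inferInstance
    rw [map_zero, groupCohomology.iCocycles_mk]
    funext g
    exact congrArg toGModule (hL _ _ _)

end CrossedTwoFoldExtension

/-! ### Liftings for matrix algebras -/

namespace QNormalStructure

variable {Q S A : Type*} [Group Q] [CommRing S] [MulSemiringAction Q S] [Ring A]
  [Algebra S A] [FaithfulSMul S A] [Algebra.IsCentral S A] (σ : QNormalStructure Q S A)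

/-- The condition on the center is automatic for a homomorphism that lifts `σ`. -/
theorem isEquivariant_iff :
    σ.IsEquivariant ↔ ∃ τ : Q →* RingAut A, (QuotientGroup.mk' (Inn A)).comp τ = σ.toHom := by
  constructor
  · rintro ⟨τ, rfl⟩
    exact ⟨τ.toHom, rfl⟩
  · rintro ⟨τ, hτ⟩
    cases σ with | mk f hf => ?_
    obtain rfl : (QuotientGroup.mk' (Inn A)).comp τ = f := hτ
    exact ⟨⟨τ, hf⟩, rfl⟩

/-- Applying automorphisms to the entries and passing to scalar matrices turns a lifting for `A`
into a lifting for `M_I(A)`. -/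
def liftingMatrix (I : Type*) [Nonempty I] (L : σ.teichmullerComplex.Lifting) :
    (σ.matrix I).teichmullerComplex.Lifting where
  sec q := ⟨(MatrixAlgebra.mapAut I (L.sec q).1.1, (L.sec q).1.2),
    congrArg (MatrixAlgebra.mapOut I) (L.sec q).2⟩
  proj_sec := L.proj_sec
  fac x y := Units.map ((MatrixAlgebra.scalar I : A →+* MatrixAlgebra I A) : A →* _) (L.fac x y)
  boundary_fac x y := by
    have h := congrArg Subtype.val (L.boundary_fac x y)
    have h1 : innerHom A (L.fac x y) * (L.sec (x * y)).1.1 = (L.sec x).1.1 * (L.sec y).1.1 :=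
      congrArg Prod.fst h
    have h2 : 1 * (L.sec (x * y)).1.2 = (L.sec x).1.2 * (L.sec y).1.2 := congrArg Prod.snd h
    refine Subtype.ext (Prod.ext ?_ h2)
    change innerHom (MatrixAlgebra I A) _ * MatrixAlgebra.mapAut I _ =
      MatrixAlgebra.mapAut I _ * MatrixAlgebra.mapAut I _
    rw [← MatrixAlgebra.mapAut_innerHom, ← map_mul, h1, map_mul]

end QNormalStructure

/-! ### Monomial matrices -/

namespace MatrixAlgebra

variable {I A : Type*} [Ring A]

theorem mapAut_scalar (α : RingAut A) (a : A) : mapAut I α (scalar I a) = scalar I (α a) := by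
  refine LinearMap.ext fun v => Finsupp.ext fun i => ?_
  rw [mapAut_apply, scalar_apply, scalar_apply]
  change α (a * α⁻¹ (v i)) = α a * v i
  rw [map_mul]
  exact congrArg (α a * ·) (α.apply_symm_apply (v i))

/-- The endomorphism `v ↦ (d i * v (π i))_i` of `⨁_I A`, given by a monomial matrix. -/
def monomialEnd (π : Equiv.Perm I) (d : I → A) : MatrixAlgebra I A where
  toFun v := Finsupp.onFinset (v.support.map π.symm.toEmbedding) (fun i => d i * v (π i))
    fun i hi => by
      refine Finset.mem_map.2 ⟨π i, ?_, π.symm_apply_apply i⟩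
      rw [Finsupp.mem_support_iff]
      exact right_ne_zero_of_mul hi
  map_add' v w := Finsupp.ext fun i => mul_add _ _ _
  map_smul' c v := Finsupp.ext fun i => (mul_assoc _ _ _).symm

theorem monomialEnd_apply (π : Equiv.Perm I) (d : I → A) (v : I →₀ A) (i : I) :
    monomialEnd π d v i = d i * v (π i) := rfl

/-- The invertible monomial matrix with unit entries `d`. -/
def monomialUnit (π : Equiv.Perm I) (d : I → Aˣ) : (MatrixAlgebra I A)ˣ where
  val := monomialEnd π fun i => d i
  inv := monomialEnd π.symm fun i => ((d (π.symm i))⁻¹ : Aˣ)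
  val_inv := by
    refine LinearMap.ext fun v => Finsupp.ext fun i => ?_
    rw [Module.End.mul_apply, monomialEnd_apply, monomialEnd_apply, π.symm_apply_apply,
      Units.mul_inv_cancel_left]
    rfl
  inv_val := by
    refine LinearMap.ext fun v => Finsupp.ext fun i => ?_
    rw [Module.End.mul_apply, monomialEnd_apply, monomialEnd_apply, π.apply_symm_apply,
      Units.inv_mul_cancel_left]
    rfl

theorem mapAut_smul_monomialUnit_mul (α : RingAut A) (π ρ : Equiv.Perm I) (d e : I → Aˣ) :
    mapAut I α • monomialUnit π d * monomialUnit ρ e =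
      monomialUnit (ρ * π) fun i => α • d i * e (π i) := by
  refine Units.ext (LinearMap.ext fun v => Finsupp.ext fun i => ?_)
  change α (d i * α⁻¹ (e (π i) * v (ρ (π i)))) = α (d i) * e (π i) * v (ρ (π i))
  rw [map_mul, mul_assoc]
  exact congrArg (α (d i) * ·) (α.apply_symm_apply _)

theorem scalar_mul_monomialUnit (a : Aˣ) (π : Equiv.Perm I) (d : I → Aˣ) :
    Units.map ((scalar I : A →+* MatrixAlgebra I A) : A →* MatrixAlgebra I A) a *
      monomialUnit π d = monomialUnit π fun i => a * d i :=
  Units.ext (LinearMap.ext fun _ => Finsupp.ext fun _ => (mul_assoc (a : A) _ _).symm)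

end MatrixAlgebra

/-! ### The Teichmüller class and equivariance of matrix algebras -/

namespace QNormalStructure

section

variable {Q S A : Type*} [Group Q] [CommRing S] [MulSemiringAction Q S] [Ring A]
  [Algebra S A] [FaithfulSMul S A] [Algebra.IsCentral S A] (σ : QNormalStructure Q S A)

/-- Scalar matrices and entrywise automorphisms do not change the 3-cocycle. -/
theorem cochain_liftingMatrix (I : Type*) [Nonempty I] (L : σ.teichmullerComplex.Lifting)
    (x y z : Q) : (σ.liftingMatrix I L).cochain x y z = L.cochain x y z := by
  let φ : Aˣ →* (MatrixAlgebra I A)ˣ :=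
    Units.map ((MatrixAlgebra.scalar I : A →+* MatrixAlgebra I A) : A →* _)
  have hs : ∀ (b : RingAut A) (u : Aˣ), MatrixAlgebra.mapAut I b • φ u = φ (b • u) := fun b u =>
    Units.ext (MatrixAlgebra.mapAut_scalar b u)
  have hi : (σ.matrix I).teichmullerComplex.incl (L.cochain x y z) =
      φ (σ.teichmullerComplex.incl (L.cochain x y z)) := by
    refine Units.ext (LinearMap.ext fun v => Finsupp.ext fun i => ?_)
    exact Algebra.smul_def _ _
  refine (σ.liftingMatrix I L).eq_cochain ?_
  rw [hi]
  change MatrixAlgebra.mapAut I (L.sec x).1.1 • φ (L.fac y z) * φ (L.fac x (y * z)) =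
    _ * (φ (L.fac x y) * φ (L.fac (x * y) z))
  rw [hs, ← map_mul, ← map_mul, ← map_mul]
  exact congrArg φ (L.cochain_spec x y z)

/-- A lifting with trivial cochain defines a crossed product `⨁_q A e_q`. Correcting the entrywise
automorphisms of `M_I(A)`, for `I` in bijection with `Q`, by the monomial matrices of right
multiplication by the `e_x` makes them multiplicative in `x`. -/
theorem isEquivariant_matrix_of_cochain_eq_one {I : Type*} [Nonempty I] (ε : I ≃ Q)
    (L : σ.teichmullerComplex.Lifting) (hL : ∀ x y z, L.cochain x y z = 1) :
    (σ.matrix I).IsEquivariant := by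
  let α : Q → RingAut A := fun q => (L.sec q).1.1
  have hα : ∀ q, QuotientGroup.mk' (Inn A) (α q) = σ.toHom q := fun q => by
    have h1 : QuotientGroup.mk' (Inn A) (L.sec q).1.1 = σ.toHom (L.sec q).1.2 := (L.sec q).2
    have h2 : (L.sec q).1.2 = q := L.proj_sec q
    rwa [h2] at h1
  have hf : ∀ x y, innerHom A (L.fac x y) * α (x * y) = α x * α y := fun x y =>
    congrArg Prod.fst (congrArg Subtype.val (L.boundary_fac x y))
  have hc : ∀ x y z, α x • L.fac y z * L.fac x (y * z) = L.fac x y * L.fac (x * y) z :=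
    fun x y z => by
      have h := L.cochain_spec x y z
      rw [hL, map_one, one_mul] at h
      exact h
  let φ : Aˣ →* (MatrixAlgebra I A)ˣ :=
    Units.map ((MatrixAlgebra.scalar I : A →+* MatrixAlgebra I A) : A →* _)
  -- In the crossed product `⨁_q e_q A`, where `e_x e_y = f(x, y) e_{xy}` and `e_q a = α_q(a) e_q`,
  -- right multiplication by `e_x` is `v ↦ α_x⁻¹(W x v)`. Conjugation by its inverse is the action
  -- of `x` on the endomorphisms of the right `A`-module `⨁_q e_q A`.
  let π : Q → Equiv.Perm I := fun x => (ε.trans (Equiv.mulRight x⁻¹)).trans ε.symm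
  let d : Q → I → Aˣ := fun x i => (α (ε i * x⁻¹))⁻¹ • L.fac (ε i * x⁻¹) x
  let W : Q → (MatrixAlgebra I A)ˣ := fun x => MatrixAlgebra.monomialUnit (π x) (d x)
  have hπ : ∀ x i, ε (π x i) = ε i * x⁻¹ := fun x i => ε.apply_symm_apply _
  have hW : ∀ x y, MatrixAlgebra.mapAut I (α x) • W y * W x = φ (L.fac x y) * W (x * y) := by
    intro x y
    have h1 : π x * π y = π (x * y) := by
      refine Equiv.ext fun i => ε.injective ?_
      rw [Equiv.Perm.mul_apply, hπ, hπ, hπ, mul_inv_rev, mul_assoc]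
    have h2 : (fun i => α x • d y i * d x (π y i)) = fun i => L.fac x y * d (x * y) i := by
      funext i
      dsimp only [d]
      rw [hπ]
      obtain ⟨p, hp⟩ : ∃ p, ε i = p * x * y := ⟨ε i * y⁻¹ * x⁻¹, by group⟩
      have e1 : p * x * y * (x * y)⁻¹ = p := by group
      rw [hp, mul_inv_cancel_right, mul_inv_cancel_right, e1]
      -- Applying `α p` turns the identity into the cocycle identity at `(p, x, y)`.
      refine smul_left_cancel (α p) ?_
      have h3 : α p • α x • (α (p * x))⁻¹ • L.fac (p * x) y =
          L.fac p x * L.fac (p * x) y * (L.fac p x)⁻¹ := by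
        rw [← mul_smul, ← mul_smul, ← hf, mul_inv_cancel_right]
        exact Units.ext rfl
      rw [smul_mul', smul_mul', smul_inv_smul, smul_inv_smul, h3, inv_mul_cancel_right, hc]
    rw [MatrixAlgebra.scalar_mul_monomialUnit, MatrixAlgebra.mapAut_smul_monomialUnit_mul, h1, h2]
  rw [isEquivariant_iff]
  refine ⟨MonoidHom.mk' (fun x =>
    innerHom (MatrixAlgebra I A) (W x)⁻¹ * MatrixAlgebra.mapAut I (α x)) ?_, ?_⟩
  · intro x y
    have h1 : (W x)⁻¹ * MatrixAlgebra.mapAut I (α x) • (W y)⁻¹ * φ (L.fac x y) =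
        (W (x * y))⁻¹ := by
      have h := hW x y
      rw [eq_inv_iff_mul_eq_one, mul_assoc, ← h, smul_inv']
      group
    have h2 : MatrixAlgebra.mapAut I (α x) * MatrixAlgebra.mapAut I (α y) =
        innerHom (MatrixAlgebra I A) (φ (L.fac x y)) * MatrixAlgebra.mapAut I (α (x * y)) := by
      rw [← MatrixAlgebra.mapAut_innerHom, ← map_mul, ← map_mul, hf]
    rw [← h1, map_mul, map_mul, innerHom_smul,
      mul_assoc _ (innerHom (MatrixAlgebra I A) (φ _)), ← h2]
    group
  · refine MonoidHom.ext fun x => ?_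
    change QuotientGroup.mk' (Inn _)
      (innerHom (MatrixAlgebra I A) (W x)⁻¹ * MatrixAlgebra.mapAut I (α x)) = _
    rw [map_mul, (Out.mk_eq_one_iff _).2 ⟨_, rfl⟩, one_mul]
    exact congrArg (MatrixAlgebra.mapOut I) (hα x)

end

section

variable {Q S : Type u} {A : Type*} [Group Q] [CommRing S] [MulSemiringAction Q S]
  [Ring A] [Algebra S A] [FaithfulSMul S A] [Algebra.IsCentral S A] (σ : QNormalStructure Q S A)

theorem teichmullerClass_eq_zero_iff : σ.teichmullerClass = 0 ↔
    ∃ L : σ.teichmullerComplex.Lifting, ∀ x y z, L.cochain x y z = 1 :=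
  CrossedTwoFoldExtension.cohomologyClass_eq_zero_iff

variable {σ} in
/-- An action of `Q` on `A` is a multiplicative section, so all factors can be taken to be `1`. -/
theorem IsEquivariant.teichmullerClass_eq_zero (h : σ.IsEquivariant) :
    σ.teichmullerClass = 0 := by
  obtain ⟨τ, hτ⟩ := σ.isEquivariant_iff.1 h
  let L : σ.teichmullerComplex.Lifting :=
    { sec := fun q => ⟨(τ q, q), DFunLike.congr_fun hτ q⟩
      proj_sec := fun q => rfl
      fac := fun _ _ => 1
      boundary_fac := fun x y => by
        rw [map_one, one_mul]
        exact Subtype.ext (Prod.ext (map_mul τ x y) rfl) }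
  refine σ.teichmullerClass_eq_zero_iff.2 ⟨L, fun x y z => L.eq_cochain ?_⟩
  change L.sec x • (1 : Aˣ) * 1 = _ * (1 * 1)
  rw [smul_one, map_one, one_mul, one_mul]

/-- The Teichmüller class is invariant under passage to matrix algebras. -/
theorem teichmullerClass_matrix (I : Type*) [Nonempty I] :
    (σ.matrix I).teichmullerClass = σ.teichmullerClass := by
  obtain ⟨L⟩ := σ.teichmullerComplex.nonempty_lifting
  have h : (σ.liftingMatrix I L).cochain3 = L.cochain3 := by
    funext g
    exact congrArg toGModule (σ.cochain_liftingMatrix I L _ _ _)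
  unfold teichmullerClass
  rw [← L.cohomologyClass_eq, ← (σ.liftingMatrix I L).cohomologyClass_eq]
  unfold CrossedTwoFoldExtension.Lifting.cohomologyClass
  congr 2

theorem teichmullerClass_eq_zero_iff_isEquivariant_matrix {I : Type*} [Nonempty I] (ε : I ≃ Q) :
    σ.teichmullerClass = 0 ↔ (σ.matrix I).IsEquivariant := by
  constructor
  · intro h
    obtain ⟨L, hL⟩ := σ.teichmullerClass_eq_zero_iff.1 h
    exact σ.isEquivariant_matrix_of_cochain_eq_one ε L hL
  · intro h
    rw [← σ.teichmullerClass_matrix I]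
    exact h.teichmullerClass_eq_zero

end

end QNormalStructure

/-! ### Galois descent -/

section Descent

variable {Q S A : Type*} [Group Q] [CommRing S] [MulSemiringAction Q S] [Ring A] [Algebra S A]

/-- Elements `xᵢ, yᵢ` of `S` with `∑ xᵢ q(yᵢ) = δ_{q,1}`, from the surjectivity of
`S ⊗_R S → Map(Q, S)`. -/
theorem IsGaloisExtension.exists_sum_mul_smul [DecidableEq Q] (h : IsGaloisExtension Q S) :
    ∃ T : Finset (S × S), ∀ q : Q, ∑ p ∈ T, p.1 * q • p.2 = if q = 1 then 1 else 0 := by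
  obtain ⟨t, ht⟩ := h.bijective.2 fun q => if q = 1 then 1 else 0
  obtain ⟨T, rfl⟩ := TensorProduct.exists_finset t
  refine ⟨T, fun q => ?_⟩
  rw [← congrFun ht q, map_sum, Finset.sum_apply]
  rfl

/-- The elements of `A` fixed by an action of `Q`, as an algebra over `S^Q`. -/
def fixedSubalgebra (τ : Q →* RingAut A)
    (hτ : ∀ q s, τ q (algebraMap S A s) = algebraMap S A (q • s)) :
    Subalgebra (fixedSubring Q S) A where
  carrier := {a | ∀ q : Q, τ q a = a}
  mul_mem' ha hb q := by rw [map_mul, ha q, hb q]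
  add_mem' ha hb q := by rw [map_add, ha q, hb q]
  algebraMap_mem' r q := (hτ q r).trans (congrArg (algebraMap S A) (r.2 q))

variable (τ : Q →* RingAut A) (hτ : ∀ q s, τ q (algebraMap S A s) = algebraMap S A (q • s))

/-- The multiplication map `S ⊗_R A^Q → A`, with `R = S^Q`. -/
def descentHom : S ⊗[fixedSubring Q S] fixedSubalgebra τ hτ →ₐ[S] A :=
  Algebra.TensorProduct.lift (Algebra.ofId S A) (fixedSubalgebra τ hτ).val
    fun s b => Algebra.commutes s (b : A)

theorem descentHom_tmul (s : S) (b : fixedSubalgebra τ hτ) :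
    descentHom τ hτ (s ⊗ₜ b) = algebraMap S A s * b := rfl

theorem descentHom_scalarExtensionAut (q : Q)
    (t : S ⊗[fixedSubring Q S] fixedSubalgebra τ hτ) :
    descentHom τ hτ (scalarExtensionAut S _ q t) = τ q (descentHom τ hτ t) := by
  induction t with
  | zero => simp
  | add t u ht hu => rw [map_add, map_add, map_add, map_add, ht, hu]
  | tmul s b =>
    change algebraMap S A (q • s) * b = τ q (algebraMap S A s * b)
    rw [map_mul, hτ, b.2 q]

/-- The trace `a ↦ ∑_q q(a)` with values in the fixed subalgebra. -/
def fixedTrace [Fintype Q] : A →+ fixedSubalgebra τ hτ where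
  toFun a := ⟨∑ q, τ q a, fun x => by
    rw [map_sum]
    refine Fintype.sum_equiv (Equiv.mulLeft x) _ _ fun q => ?_
    rw [Equiv.coe_mulLeft, map_mul]
    rfl⟩
  map_zero' := Subtype.ext (by simp)
  map_add' a b := Subtype.ext (by simp [Finset.sum_add_distrib])

/-- Galois descent: with `∑ xᵢ q(yᵢ) = δ_{q,1}`, the inverse of the multiplication map is
`a ↦ ∑ xᵢ ⊗ tr(yᵢ a)`. -/
theorem descentHom_bijective (h : IsGaloisExtension Q S) :
    Function.Bijective (descentHom τ hτ) := by
  classical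
  have := h.finite
  have := Fintype.ofFinite Q
  obtain ⟨T, hT⟩ := h.exists_sum_mul_smul
  let ψ : A →+ S ⊗[fixedSubring Q S] fixedSubalgebra τ hτ :=
    ∑ p ∈ T, (TensorProduct.mk (fixedSubring Q S) S (fixedSubalgebra τ hτ) p.1).toAddMonoidHom.comp
      ((fixedTrace τ hτ).comp (AddMonoidHom.mulLeft (algebraMap S A p.2)))
  have hψ : ∀ a, ψ a = ∑ p ∈ T, p.1 ⊗ₜ fixedTrace τ hτ (algebraMap S A p.2 * a) := fun a => by
    simp only [ψ, AddMonoidHom.finsetSum_apply]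
    rfl
  have left : ∀ t, ψ (descentHom τ hτ t) = t := by
    intro t
    induction t with
    | zero => simp
    | add t u ht hu => rw [map_add, map_add, ht, hu]
    | tmul s b =>
      rw [hψ, descentHom_tmul]
      have htr : ∀ y : S, ∃ r : fixedSubring Q S, (r : S) = ∑ q : Q, q • (y * s) ∧
          fixedTrace τ hτ (algebraMap S A y * (algebraMap S A s * b)) = r • b := by
        intro y
        refine ⟨⟨∑ q : Q, q • (y * s), fun x => ?_⟩, rfl, Subtype.ext ?_⟩
        · rw [Finset.smul_sum]
          refine Fintype.sum_equiv (Equiv.mulLeft x) _ _ fun q => ?_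
          rw [Equiv.coe_mulLeft, mul_smul]
        · change ∑ q : Q, τ q (algebraMap S A y * (algebraMap S A s * b)) =
            (∑ q : Q, q • (y * s)) • (b : A)
          rw [Finset.sum_smul]
          refine Finset.sum_congr rfl fun q _ => ?_
          rw [← mul_assoc, ← map_mul, map_mul, hτ, b.2 q, Algebra.smul_def]
      choose r hr hrb using htr
      simp_rw [hrb, ← TensorProduct.smul_tmul, ← TensorProduct.sum_tmul]
      congr 1
      calc ∑ p ∈ T, r p.2 • p.1 = ∑ p ∈ T, ∑ q : Q, q • s * (p.1 * q • p.2) := by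
            refine Finset.sum_congr rfl fun p _ => ?_
            rw [Subring.smul_def, hr, smul_eq_mul, Finset.sum_mul]
            refine Finset.sum_congr rfl fun q _ => ?_
            rw [smul_mul']
            ring
        _ = ∑ q : Q, q • s * if q = 1 then 1 else 0 := by
            rw [Finset.sum_comm]
            simp_rw [← Finset.mul_sum, hT]
        _ = s := by simp
  have right : ∀ a, descentHom τ hτ (ψ a) = a := by
    intro a
    rw [hψ, map_sum]
    calc ∑ p ∈ T, descentHom τ hτ (p.1 ⊗ₜ fixedTrace τ hτ (algebraMap S A p.2 * a))
        = ∑ p ∈ T, ∑ q : Q, algebraMap S A (p.1 * q • p.2) * τ q a := by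
          refine Finset.sum_congr rfl fun p _ => ?_
          rw [descentHom_tmul]
          change algebraMap S A p.1 * ∑ q : Q, τ q (algebraMap S A p.2 * a) = _
          rw [Finset.mul_sum]
          refine Finset.sum_congr rfl fun q _ => ?_
          rw [map_mul, map_mul, hτ, mul_assoc]
      _ = ∑ q : Q, algebraMap S A (if q = 1 then 1 else 0) * τ q a := by
          rw [Finset.sum_comm]
          simp_rw [← Finset.sum_mul, ← map_sum, hT]
      _ = a := by
          rw [Finset.sum_eq_single 1 (fun q _ hq => by simp [hq]) (by simp)]
          simp
  exact ⟨Function.LeftInverse.injective left, Function.RightInverse.surjective right⟩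

end Descent

/-! ### Scalar extension -/

namespace QNormalStructure

variable {Q S A : Type*} [Group Q] [CommRing S] [MulSemiringAction Q S] [Ring A]
  [Algebra S A] [FaithfulSMul S A] [Algebra.IsCentral S A] {σ : QNormalStructure Q S A}

theorem ArisesByScalarExtension.isEquivariant (h : σ.ArisesByScalarExtension) :
    σ.IsEquivariant := by
  obtain ⟨B, _, _, _, _, e, he⟩ := h
  refine σ.isEquivariant_iff.2 ⟨MonoidHom.mk' (fun q =>
    (e.symm.toRingEquiv.trans (scalarExtensionAut S B q)).trans e.toRingEquiv) fun x y => ?_,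
    MonoidHom.ext fun q => (he q).symm⟩
  have hmul : ∀ t, scalarExtensionAut S B (x * y) t =
      scalarExtensionAut S B x (scalarExtensionAut S B y t) := by
    intro t
    induction t with
    | zero => simp
    | add t u ht hu => rw [map_add, map_add, map_add, ht, hu]
    | tmul s b => exact congrArg (· ⊗ₜ b) (mul_smul x y s)
  refine RingEquiv.ext fun a => ?_
  change e (scalarExtensionAut S B (x * y) (e.symm a)) =
    e (scalarExtensionAut S B x (e.symm (e (scalarExtensionAut S B y (e.symm a)))))
  rw [hmul, e.symm_apply_apply]

theorem IsEquivariant.arisesByScalarExtension (hQ : IsGaloisExtension Q S)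
    (h : σ.IsEquivariant) : σ.ArisesByScalarExtension := by
  obtain ⟨τ, h⟩ := σ.isEquivariant_iff.1 h
  have hτ : ∀ q s, τ q (algebraMap S A s) = algebraMap S A (q • s) := fun q s =>
    σ.apply_algebraMap (DFunLike.congr_fun h q) s
  have inj := FaithfulSMul.algebraMap_injective S A
  let e := AlgEquiv.ofBijective (descentHom τ hτ) (descentHom_bijective τ hτ hQ)
  have he : ∀ q t, e (scalarExtensionAut S _ q t) = τ q (e t) := descentHom_scalarExtensionAut τ hτ
  refine ⟨fixedSubalgebra τ hτ, inferInstance, inferInstance, ?_, ⟨?_⟩, e, fun q => ?_⟩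
  · rw [faithfulSMul_iff_algebraMap_injective]
    exact fun r r' hr => Subtype.ext (inj (congrArg Subtype.val hr))
  · intro b hb
    rw [Subalgebra.mem_center_iff] at hb
    have hc : ∀ a : A, a * b = b * a := by
      intro a
      obtain ⟨t, rfl⟩ := e.surjective a
      induction t with
      | zero => simp
      | add t u ht hu => rw [map_add, add_mul, mul_add, ht, hu]
      | tmul s c =>
        change algebraMap S A s * c * b = b * (algebraMap S A s * c)
        have hcb : (c : A) * (b : A) = (b : A) * (c : A) := congrArg Subtype.val (hb c)
        rw [mul_assoc, hcb, Algebra.left_comm]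
    obtain ⟨s, hs⟩ := Algebra.mem_bot.1 (Algebra.IsCentral.out (K := S) (D := A)
      (Subalgebra.mem_center_iff.2 hc))
    refine Algebra.mem_bot.2 ⟨⟨s, fun q => inj ?_⟩, Subtype.ext hs⟩
    rw [← hτ, hs, b.2 q]
  · rw [← h]
    refine congrArg (QuotientGroup.mk' (Inn A)) (RingEquiv.ext fun a => ?_)
    change τ q a = e (scalarExtensionAut S _ q (e.symm a))
    rw [he, e.apply_symm_apply]

end QNormalStructure

end

theorem theorem4p1 {Q S : Type u} {A : Type v} [Group Q] [CommRing S] [MulSemiringAction Q S]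
    [Ring A] [Algebra S A] [FaithfulSMul S A] [Algebra.IsCentral S A]
    (σ : QNormalStructure Q S A) :
    (σ.teichmullerClass = 0 ↔ (σ.matrix Q).IsEquivariant) ∧
      (IsGaloisExtension Q S →
        (σ.teichmullerClass = 0 ↔
          ∃ (I : Type w) (_ : Nonempty I), (σ.matrix I).ArisesByScalarExtension)) := by
  refine ⟨σ.teichmullerClass_eq_zero_iff_isEquivariant_matrix (Equiv.refl Q), fun hQ => ⟨?_, ?_⟩⟩
  · intro h
    have := hQ.finite
    -- `Q` is finite, so it has a copy in every universe.
    let ε : ULift.{w} (Fin (Nat.card Q)) ≃ Q := Equiv.ulift.trans (Finite.equivFin Q).symm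
    have : Nonempty (ULift.{w} (Fin (Nat.card Q))) := ⟨ε.symm 1⟩
    exact ⟨_, inferInstance,
      ((σ.teichmullerClass_eq_zero_iff_isEquivariant_matrix ε).1 h).arisesByScalarExtension hQ⟩
  · rintro ⟨I, hI, h⟩
    rw [← σ.teichmullerClass_matrix I]
    exact h.isEquivariant.teichmullerClass_eq_zero
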